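/- Let $C$ be a smooth projective geometrically irreducible curve over a finite field $\mathbb{F}_q$ with function field $K$, let $\infty$ be a closed point of $C$, let $A=H^0(C\setminus\{\infty\},\mathcal{O}_C)$ be the ring of functions regular outside $\infty$, and let $\mathbb{C}_\infty$ be the completion of an algebraic closure of $K$ at a place above $\infty$. Let $L$ be a field with $K\subseteq L\subseteq \mathbb{C}_\infty$ and let $L\{\tau\}$ be the ring of twisted polynomials over $L$, in which $\tau l=l^q\tau$ for $l\in L$; it acts on $\mathbb{C}_\infty$ with $\tau$ acting as $x\mapsto x^q$. An Anderson $A$-module $E$ of dimension $d$ over $L$ (of generic characteristic) is given, in coordinates $E\cong\mathbb{G}_{a,L}^d$, by a ring homomorphism $\phi:A\to \mathrm{Mat}_{d}(L\{\tau\})=\mathrm{End}_{\mathbb{F}_q}(\mathbb{G}_{a,L}^d)$, $a\mapsto\phi_a$, such that for every $a\in A$ the matrix $d\phi_a-a\cdot 1_d$ is nilpotent, where $d\phi_a\in\mathrm{Mat}_d(L)$ is the constant coefficient of $\phi_a$. Its exponential map is the unique map $e:\mathrm{Lie}(E)=\mathbb{C}_\infty^d\to E(\mathbb{C}_\infty)=\mathbb{C}_\infty^d$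 that is given by an everywhere convergent power series $e(x)=\sum_{n\ge 0}c_n x^{(q^n)}$, with $c_n\in\mathrm{Mat}_d(\mathbb{C}_\infty)$, $c_0=1_d$, and $x^{(q^n)}$ the coordinatewise $q^n$-th power, and that satisfies $\phi_a(e(x))=e(d\phi_a\,x)$ for all $a\in A$ and $x\in\mathrm{Lie}(E)$. The module $E$ is called uniformizable if $e$ is surjective. For a nonzero ideal $\mathfrak{a}$ of $A$ put $E[\mathfrak{a}]=\{x\in E(\mathbb{C}_\infty) : \phi_a(x)=0\text{ for all }a\in\mathfrak{a}\}$, which is an $A/\mathfrak{a}$-module via $\phi$. Then every uniformizable Anderson $A$-module $E$ is regular in the sense of Yu: there is an integer $r\ge 0$ such that, for every nonzero ideal $\mathfrak{a}$ of $A$, the $A/\mathfrak{a}$-module $E[\mathfrak{a}]$ is free of rank $r$, i.e. isomorphic to $(A/\mathfrak{a})^r$. -/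

import Mathlib

open scoped IntermediateField

noncomputable section

/-! ## Curves over a finite field, in the language of function fields

A smooth projective geometrically irreducible curve `C` over the finite field `F` is given by its
function field `K`; its closed points are the places of `K` over `F`, i.e. the local rings
`𝒪_{C,P}`, which are exactly the valuation rings of `K` that contain `F` and are not `K` itself. -/

/-- `K` is the function field of a smooth projective geometrically irreducible curve over the
(perfect) field `F`: it is a finite extension of a rational function field `F(x)`, and `F` is
algebraically closed in `K`. -/
structure IsCurveFunctionField (F K : Type*) [Field F] [Field K] [Algebra F K] : Prop where
  exists_finite : ∃ x : K, Transcendental F x ∧ FiniteDimensional F⟮x⟯ K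
  mem_range_of_isAlgebraic : ∀ x : K, IsAlgebraic F x → x ∈ Set.range (algebraMap F K)

/-- The closed points of the curve with function field `K`, as valuation rings of `K`. -/
def IsClosedPoint (F : Type*) {K : Type*} [Field F] [Field K] [Algebra F K]
    (P : ValuationSubring K) : Prop :=
  P ≠ ⊤ ∧ ∀ c : F, algebraMap F K c ∈ P

/-- The ring `A = H⁰(C ∖ {∞}, 𝒪_C)` of all functions that are regular at every closed point
different from `∞`. -/
def ringRegularOutside (F : Type*) {K : Type*} [Field F] [Field K] [Algebra F K]
    (infty : ValuationSubring K) : Subalgebra F K where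
  carrier := {x | ∀ P : ValuationSubring K, IsClosedPoint F P → P ≠ infty → x ∈ P}
  mul_mem' := fun hx hy P hP hne => P.mul_mem _ _ (hx P hP hne) (hy P hP hne)
  add_mem' := fun hx hy P hP hne => P.add_mem _ _ (hx P hP hne) (hy P hP hne)
  algebraMap_mem' := fun c _ hP _ => hP.2 c

/-- For a place `w` of the algebraic closure of `K`, the completion `ℂ_∞` of the algebraic closure
with respect to the (valuation topology of the) place `w`. -/
abbrev CInfty {K : Type*} [Field K] (w : ValuationSubring (AlgebraicClosure K)) : Type _ :=
  w.valuation.Completion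

instance {R K Γ₀ : Type*} [CommSemiring R] [Field K] [Algebra R K]
    [LinearOrderedCommGroupWithZero Γ₀] (v : Valuation K Γ₀) :
    UniformContinuousConstSMul R (WithVal v) where
  uniformContinuous_const_smul r := by
    have h : (fun x : WithVal v => r • x) = fun x => algebraMap R (WithVal v) r * x :=
      funext fun x => Algebra.smul_def r x
    rw [h]
    exact uniformContinuous_mul_left' _

/-! ## Twisted polynomials -/

/-- A copy of the `F`-algebra `L`, on which `n : ℕ` acts as the `n`-th power of the Frobenius
endomorphism `x ↦ x ^ q`, where `q` is the cardinality of `F`. -/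
def FrobeniusCopy (_F L : Type*) : Type _ := L

instance (F L : Type*) [Field L] : Field (FrobeniusCopy F L) := inferInstanceAs (Field L)

theorem add_pow_card_pow (F : Type*) {L : Type*} [Field F] [Fintype F] [Field L] [Algebra F L]
    (n : ℕ) (x y : L) :
    (x + y) ^ Fintype.card F ^ n = x ^ Fintype.card F ^ n + y ^ Fintype.card F ^ n := by
  have h (z : L) : (FiniteField.frobeniusAlgHom F L)^[n] z = z ^ Fintype.card F ^ n := by
    rw [FiniteField.coe_frobeniusAlgHom, pow_iterate]
  rw [← h, ← h, ← h, iterate_map_add]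

instance (F L : Type*) [Field F] [Fintype F] [Field L] [Algebra F L] :
    MulSemiringAction (Multiplicative ℕ) (FrobeniusCopy F L) where
  smul n x := x ^ Fintype.card F ^ n.toAdd
  one_smul x := by
    change x ^ Fintype.card F ^ 0 = x
    simp
  mul_smul m n x := by
    change x ^ Fintype.card F ^ (m.toAdd + n.toAdd) =
      (x ^ Fintype.card F ^ n.toAdd) ^ Fintype.card F ^ m.toAdd
    rw [← pow_mul, ← pow_add, add_comm]
  smul_zero n := zero_pow (pow_ne_zero _ Fintype.card_ne_zero)
  smul_add n x y := add_pow_card_pow F (L := L) n.toAdd x y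
  smul_one n := one_pow _
  smul_mul n x y := mul_pow x y _

/-- The ring `L{τ} = End_{𝔽_q-v.s.}(𝔾_{a,L})` of twisted polynomials `∑ lₙ τⁿ`, in which
`τ l = l ^ q τ`. -/
abbrev TwistedPolynomial (F L : Type*) [Field F] [Fintype F] [Field L] [Algebra F L] : Type _ :=
  SkewPolynomial (FrobeniusCopy F L)

namespace TwistedPolynomial

variable {F L : Type*} [Field F] [Fintype F] [Field L] [Algebra F L]
/-- The coefficient of `τⁿ` in a twisted polynomial, as an element of `L`. -/
def coeff (f : TwistedPolynomial F L) (n : ℕ) : L := SkewPolynomial.coeff f n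

variable (C : Type*) [Field C] [Algebra F C] [Algebra L C]

/-- The action of `L{τ}` on the points of `𝔾_a` with values in an extension field `C` of `L`:
`l` acts by multiplication and `τ` acts as the `q`-power Frobenius. -/
def eval : TwistedPolynomial F L →+* Module.End F C :=
  SkewMonoidAlgebra.liftNCRingHom (k := FrobeniusCopy F L) (G := Multiplicative ℕ)
    ((Algebra.lmul F C).toRingHom.comp (algebraMap L C) : L →+* Module.End F C)
    ((powersHom _ (FiniteField.frobeniusAlgHom F C).toLinearMap))
    (by
      intro l n
      ext x
      have h (m : ℕ) (z : C) : ((FiniteField.frobeniusAlgHom F C).toLinearMap ^ m) z =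
          z ^ Fintype.card F ^ m := by
        rw [Module.End.pow_apply]
        exact congrFun (pow_iterate (Fintype.card F) m) z
      change algebraMap L C ((show L from l) ^ Fintype.card F ^ n.toAdd) *
          ((FiniteField.frobeniusAlgHom F C).toLinearMap ^ n.toAdd) x =
        ((FiniteField.frobeniusAlgHom F C).toLinearMap ^ n.toAdd)
          (algebraMap L C (show L from l) * x)
      rw [h, h, map_pow, mul_pow])

theorem eval_monomial (n : ℕ) (l : L) (x : C) :
    eval C (SkewPolynomial.monomial (R := FrobeniusCopy F L) n l) x =
      algebraMap L C l * x ^ Fintype.card F ^ n := by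
  have h : eval C (SkewPolynomial.monomial (R := FrobeniusCopy F L) n l) =
      Algebra.lmul F C (algebraMap L C l) * (FiniteField.frobeniusAlgHom F C).toLinearMap ^ n :=
    SkewMonoidAlgebra.liftNC_single _ _ _ _
  rw [h, Module.End.mul_apply, Module.End.pow_apply]
  exact congrArg (algebraMap L C l * ·) (congrFun (pow_iterate (Fintype.card F) n) x)

theorem eval_apply (f : TwistedPolynomial F L) (x : C) :
    eval C f x =
      ∑ n ∈ SkewPolynomial.support f, algebraMap L C (coeff f n) * x ^ Fintype.card F ^ n := by
  conv_lhs => rw [← SkewPolynomial.sum_monomial f, SkewPolynomial.sum_def]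
  rw [map_sum, LinearMap.sum_apply]
  exact Finset.sum_congr rfl fun n _ => eval_monomial C n _ x

end TwistedPolynomial

/-! ## Anderson modules -/

/-- An Anderson `A`-module over `L` of dimension `d`, in a coordinate system `E ≅ 𝔾_{a,L}^d` (so
that `End_{𝔽_q-v.s.}(E)` is the matrix ring over `L{τ}`): a ring homomorphism
`φ : A → Mat_d(L{τ})` such that `dφ_a - ℓ(a)` is nilpotent for all `a`. Here `dφ_a` is the matrix
of constant coefficients of `φ_a`, and `ℓ : A → L` is the structure map. -/
structure AndersonModule (F A L : Type*) [Field F] [Fintype F] [CommRing A] [Field L]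
    [Algebra F L] [Algebra A L] (d : ℕ) where
  φ : A →+* Matrix (Fin d) (Fin d) (TwistedPolynomial F L)
  isNilpotent_sub : ∀ a : A, IsNilpotent
    ((Matrix.of fun i j => TwistedPolynomial.coeff (φ a i j) 0) - Matrix.scalar (Fin d) (algebraMap A L a))

namespace AndersonModule

variable {F A L : Type*} [Field F] [Fintype F] [CommRing A] [Field L] [Algebra F L] [Algebra A L]
  {d : ℕ}

/-- The matrix of the endomorphism `dφ_a` of `Lie E`. -/
def dφ (E : AndersonModule F A L d) (a : A) : Matrix (Fin d) (Fin d) L :=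
  Matrix.of fun i j => TwistedPolynomial.coeff (E.φ a i j) 0

variable (C : Type*) [Field C] [Algebra F C] [Algebra L C]

/-- The action of `A` on `E(C) = C^d` through `φ`. -/
def action (E : AndersonModule F A L d) : A →+* Module.End F (Fin d → C) :=
  (endVecRingEquivMatrixEnd (Fin d) F C).symm.toRingHom.comp
    ((TwistedPolynomial.eval C).mapMatrix.comp E.φ)

theorem action_apply (E : AndersonModule F A L d) (a : A) (x : Fin d → C) (i : Fin d) :
    E.action C a x i = ∑ j, ∑ n ∈ SkewPolynomial.support (E.φ a i j),
      algebraMap L C (TwistedPolynomial.coeff (E.φ a i j) n) * x j ^ Fintype.card F ^ n := by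
  change ∑ j, TwistedPolynomial.eval C (E.φ a i j) (x j) = _
  simp only [TwistedPolynomial.eval_apply]

/-- The group `E(C)` of `C`-valued points of `E`, as an `A`-module via `φ`. -/
def Points (_E : AndersonModule F A L d) (C : Type*) : Type _ := Fin d → C

instance (E : AndersonModule F A L d) : AddCommGroup (E.Points C) :=
  inferInstanceAs (AddCommGroup (Fin d → C))

instance (E : AndersonModule F A L d) : Module A (E.Points C) :=
  letI : Module (Module.End F (Fin d → C)) (E.Points C) :=
    inferInstanceAs (Module (Module.End F (Fin d → C)) (Fin d → C))
  Module.compHom (E.Points C) (E.action C)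

theorem points_smul_def (E : AndersonModule F A L d) (a : A) (x : E.Points C) :
    a • x = E.action C a x := rfl

/-- The torsion `E[𝔞] = ⋂_{a ∈ 𝔞} ker φ_a ⊆ E(C)`, which is an `A/𝔞`-module. -/
abbrev torsion (E : AndersonModule F A L d) (𝔞 : Ideal A) : Submodule A (E.Points C) :=
  Submodule.torsionBySet A (E.Points C) (𝔞 : Set A)

/-- `e : Lie E → E(C)` is an exponential map of `E`: it is given by an everywhere convergent
`𝔽_q`-linear power series `e(x) = ∑ₙ cₙ x^{(qⁿ)}` with matrix coefficients, with `d e = c₀ = 1`, and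
it satisfies `φ_a (e x) = e (dφ_a x)` for all `a`. -/
def IsExponential [TopologicalSpace C] (E : AndersonModule F A L d)
    (e : (Fin d → C) → E.Points C) : Prop :=
  (∃ c : ℕ → Matrix (Fin d) (Fin d) C, c 0 = 1 ∧
    ∀ x : Fin d → C,
      HasSum (α := Fin d → C) (fun n => (c n).mulVec fun i => x i ^ Fintype.card F ^ n) (e x)) ∧
  ∀ (a : A) (x : Fin d → C), a • e x = e (((E.dφ a).map (algebraMap L C)).mulVec x)

/-- `E` is uniformizable if its exponential map is surjective. -/
def IsUniformizable [TopologicalSpace C] (E : AndersonModule F A L d) : Prop :=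
  ∃ e : (Fin d → C) → E.Points C, E.IsExponential C e ∧ Function.Surjective e

/-- `E` is regular if there is an integer `r ≥ 0` such that for all non-zero ideals `𝔞` of `A`, the
torsion `E[𝔞]` is a free `A/𝔞`-module of rank `r`. -/
def IsRegular (E : AndersonModule F A L d) : Prop :=
  ∃ r : ℕ, ∀ 𝔞 : Ideal A, 𝔞 ≠ ⊥ → Nonempty (E.torsion C 𝔞 ≃ₗ[A ⧸ 𝔞] (Fin r → A ⧸ 𝔞))

end AndersonModule

end

/-!
Write `C = ℂ_∞` and let `Λ ⊆ Lie(E)(C) = C^d` be the kernel of the exponential map `e`. Since `dφ_a`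
is the sum of the nonzero scalar `a` and a commuting nilpotent matrix, every `a ≠ 0` acts bijectively
on `Lie(E)(C)`; so if `e` is surjective, then `E(C)` is the quotient of a uniquely divisible torsion-free
`A`-module by `Λ`. The theorem says that such a quotient has the expected torsion, which holds as soon
as `A` is a Dedekind domain and `Λ` is a finitely generated `A`-module
(`IsDedekindDomain.nonempty_torsionBySet_equiv`): for `0 ≠ a ∈ 𝔞` the snake lemma gives
`E[a] ≅ Λ / aΛ`, which is free of rank `r = rank Λ` over the semilocal ring `A / (a)`, and the
`𝔞`-torsion of `A / (a)` is isomorphic to `A / 𝔞`.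

The analytic heart is the finite generation of `Λ` (`AndersonModule.IsExponential.finite_ker_linearMap`).
Since the nilpotent part of `dφ_a` is killed by a power of the characteristic, there is a `T ∈ A` with
a pole at `∞` for which `dφ_T` is the scalar `T`. Three facts are used.
* `E[T]` is finite (`AndersonModule.finite_setOf_smul_eq_zero`), because zeros of a system of additive
  polynomials with invertible linear part that are independent over `F` have Frobenius vectors that are
  independent over `C`.
* `Λ` is discrete (`AndersonModule.IsExponential.exists_forall_eq_zero`), by the ultrametric inequality.
* Every element of `C` is bounded by a power of `|T|` (`Valuation.exists_le_pow_of_isAlgebraic`),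
  because `K` is algebraic over `F(T)`.

For a bound `γ`, the map `λ ↦ e(T⁻¹ λ)` embeds `{λ ∈ Λ : |λ| ≤ γ |T|}` modulo `T {λ ∈ Λ : |λ| ≤ γ}`
into `E[T]`. Starting from a `γ` for which the smaller set is zero, it follows that there are only
finitely many periods below any bound. Division by `T` with remainder in a finite set of
representatives of `Λ / TΛ` then shows that the periods below a certain bound generate `Λ` over `F[T]`.

It also follows that `A` is a Dedekind domain. It is the integral closure of `F[T]` in `K`, hence
integrally closed of dimension at most one, and if `0 ≠ λ ∈ Λ`, then `A ≅ Aλ ⊆ Λ` is finitely generated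
over `F[T]`, so that `A` is noetherian. If `Λ = 0`, then `E(C)` is torsion-free and `r = 0`.
-/

/-! ### Torsion of quotients of uniquely divisible modules over a Dedekind domain -/

section

open scoped TensorProduct

namespace Module

/-- Over the semilocal ring `A ⧸ (a)`, flatness and constancy of the rank force freeness. -/
theorem nonempty_basis_quotient_span_singleton_tensorProduct {A : Type*} [CommRing A]
    [IsDedekindDomain A] (M : Type*) [AddCommGroup M] [Module A M] [Module.Finite A M]
    [Module.IsTorsionFree A M] {a : A} (ha : a ≠ 0) :
    Nonempty (Basis (Fin (finrank A M)) (A ⧸ Ideal.span {a}) ((A ⧸ Ideal.span {a}) ⊗[A] M)) := by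
  have : Ring.KrullDimLE 0 (A ⧸ Ideal.span {a}) := by
    rw [Ring.krullDimLE_zero_iff]
    intro P hP
    have hmax : (P.comap (Ideal.Quotient.mk (Ideal.span {a}))).IsMaximal := by
      refine (hP.comap _).isMaximal fun h => ha ?_
      have : a ∈ P.comap (Ideal.Quotient.mk (Ideal.span {a})) := by
        rw [Ideal.mem_comap, Ideal.Quotient.eq_zero_iff_mem.mpr (Ideal.mem_span_singleton_self a)]
        exact P.zero_mem
      rwa [h] at this
    exact Ideal.isMaximal_of_isIntegral_of_isMaximal_comap P hmax
  have : IsArtinianRing (A ⧸ Ideal.span {a}) := IsNoetherianRing.isArtinianRing_of_krullDimLE_zero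
  refine nonempty_basis_of_flat_of_finrank_eq _ _ _ fun P => ?_
  let N := (A ⧸ Ideal.span {a}) ⊗[A] M
  let _ : Field ((A ⧸ Ideal.span {a}) ⧸ P.1) := Ideal.Quotient.field P.1
  have h1 : finrank P.1.ResidueField (P.1.Fiber N) = finrank A M := by
    rw [Ideal.finrank_fiber_eq_rankAtStalk, rankAtStalk_baseChange, rankAtStalk_eq]
    exact Ideal.finrank_fiber_eq_finrank _
  have h2 := finrank_baseChange (R := P.1.ResidueField)
    (S := (A ⧸ Ideal.span {a}) ⧸ P.1) (M' := ((A ⧸ Ideal.span {a}) ⧸ P.1) ⊗[A ⧸ Ideal.span {a}] N)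
  rw [← h1, ← h2]
  exact (TensorProduct.AlgebraTensorModule.cancelBaseChange (A ⧸ Ideal.span {a})
    ((A ⧸ Ideal.span {a}) ⧸ P.1) P.1.ResidueField P.1.ResidueField N).finrank_eq

end Module

/-- Multiplying by a generator of `(a) : 𝔞` modulo `a` identifies `A ⧸ 𝔞` with the `𝔞`-torsion of
`A ⧸ (a)`. -/
theorem IsDedekindDomain.nonempty_quotient_equiv_torsionBySet {A : Type*} [CommRing A]
    [IsDedekindDomain A] {a : A} (ha : a ≠ 0) {𝔞 : Ideal A} (h𝔞 : a ∈ 𝔞) :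
    Nonempty ((A ⧸ 𝔞) ≃ₗ[A] Submodule.torsionBySet A (A ⧸ Ideal.span {a}) (𝔞 : Set A)) := by
  obtain ⟨𝔟, h𝔟⟩ : 𝔞 ∣ Ideal.span {a} :=
    Ideal.dvd_iff_le.mpr ((Ideal.span_singleton_le_iff_mem _).mpr h𝔞)
  have ha0 : Ideal.span {a} ≠ (0 : Ideal A) := by
    simpa [Ideal.zero_eq_bot, Ideal.span_singleton_eq_bot] using ha
  have h𝔟0 : 𝔟 ≠ 0 := by rintro rfl; exact ha0 (by rw [h𝔟, mul_zero])
  have h𝔞0 : 𝔞 ≠ 0 := by rintro rfl; exact ha0 (by rw [h𝔟, zero_mul])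
  obtain ⟨g, hg⟩ := IsDedekindDomain.exists_sup_span_eq (I := Ideal.span {a}) (J := 𝔟)
    (h𝔟 ▸ Ideal.mul_le_right) ha0
  have hmul : ∀ x, x ∈ 𝔞 ↔ ∀ y ∈ 𝔟, x * y ∈ Ideal.span {a} := by
    intro x
    refine ⟨fun hx y hy => h𝔟 ▸ Ideal.mul_mem_mul hx hy, fun h => ?_⟩
    have : Ideal.span {x} * 𝔟 ≤ 𝔞 * 𝔟 := by
      rw [← h𝔟, Ideal.mul_le]
      intro r hr s hs
      obtain ⟨c, rfl⟩ := Ideal.mem_span_singleton'.mp hr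
      rw [mul_assoc]
      exact Ideal.mul_mem_left _ _ (h s hs)
    rw [← Ideal.span_singleton_le_iff_mem]
    exact Ideal.dvd_iff_le.mp ((mul_dvd_mul_iff_right h𝔟0).mp (Ideal.dvd_iff_le.mpr this))
  have hmul' : ∀ y, y ∈ 𝔟 ↔ ∀ x ∈ 𝔞, x * y ∈ Ideal.span {a} := by
    intro y
    refine ⟨fun hy x hx => h𝔟 ▸ Ideal.mul_mem_mul hx hy, fun h => ?_⟩
    have : 𝔞 * Ideal.span {y} ≤ 𝔞 * 𝔟 := by
      rw [← h𝔟, Ideal.mul_le]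
      intro r hr s hs
      obtain ⟨c, rfl⟩ := Ideal.mem_span_singleton'.mp hs
      rw [mul_left_comm]
      exact Ideal.mul_mem_left _ _ (h r hr)
    rw [← Ideal.span_singleton_le_iff_mem]
    exact Ideal.dvd_iff_le.mp ((mul_dvd_mul_iff_left h𝔞0).mp (Ideal.dvd_iff_le.mpr this))
  let f : A →ₗ[A] A ⧸ Ideal.span {a} := LinearMap.toSpanSingleton A _ (Ideal.Quotient.mk _ g)
  have hf : ∀ x, f x = Ideal.Quotient.mk _ (x * g) := fun x => rfl
  have hker : LinearMap.ker f = 𝔞 := by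
    ext x
    rw [LinearMap.mem_ker, hf, Ideal.Quotient.eq_zero_iff_mem, hmul, ← hg]
    refine ⟨fun h y hy => ?_, fun h => h g (Ideal.mem_sup_right (Ideal.mem_span_singleton_self g))⟩
    obtain ⟨y₁, hy₁, y₂, hy₂, rfl⟩ := Submodule.mem_sup.mp hy
    obtain ⟨c, rfl⟩ := Ideal.mem_span_singleton'.mp hy₂
    rw [mul_add, mul_left_comm]
    exact add_mem (Ideal.mul_mem_left _ _ hy₁) (Ideal.mul_mem_left _ _ h)
  have hrange : LinearMap.range f = Submodule.torsionBySet A (A ⧸ Ideal.span {a}) (𝔞 : Set A) := by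
    ext z
    obtain ⟨y, rfl⟩ := Ideal.Quotient.mk_surjective z
    rw [Submodule.mem_torsionBySet_iff]
    have : (∀ x : (𝔞 : Set A), (x : A) • Ideal.Quotient.mk (Ideal.span {a}) y = 0) ↔ y ∈ 𝔟 := by
      rw [hmul', Subtype.forall]
      refine forall₂_congr fun x _ => ?_
      rw [← Ideal.Quotient.eq_zero_iff_mem, map_mul]
      rfl
    rw [this, LinearMap.mem_range, ← hg]
    constructor
    · rintro ⟨x, hx⟩
      rw [hf, Ideal.Quotient.eq] at hx
      have : y = -(x * g - y) + x * g := by ring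
      rw [this]
      exact add_mem (Ideal.mem_sup_left (neg_mem hx))
        (Ideal.mem_sup_right (Ideal.mul_mem_left _ _ (Ideal.mem_span_singleton_self g)))
    · intro hy
      obtain ⟨y₁, hy₁, y₂, hy₂, rfl⟩ := Submodule.mem_sup.mp hy
      obtain ⟨c, rfl⟩ := Ideal.mem_span_singleton'.mp hy₂
      refine ⟨c, ?_⟩
      rw [hf, Ideal.Quotient.eq]
      simpa using neg_mem hy₁
  exact ⟨(Submodule.quotEquivOfEq _ _ hker.symm).trans
    (f.quotKerEquivRange.trans (LinearEquiv.ofEq _ _ hrange))⟩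

namespace Submodule

variable {A M N ι : Type*} [CommRing A] [AddCommGroup M] [Module A M] [AddCommGroup N] [Module A N]

/-- A linear equivalence restricts to the torsion submodules. -/
def torsionBySetCongr (s : Set A) (e : M ≃ₗ[A] N) :
    torsionBySet A M s ≃ₗ[A] torsionBySet A N s :=
  e.ofSubmodules _ _ (by
    ext y
    simp only [mem_map, mem_torsionBySet_iff]
    constructor
    · rintro ⟨x, hx, rfl⟩ c
      simpa using congrArg e (hx c)
    · exact fun hy => ⟨e.symm y, fun c => by simpa using congrArg e.symm (hy c), by simp⟩)

/-- Torsion commutes with powers. -/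
def torsionBySetPi (s : Set A) :
    torsionBySet A (ι → M) s ≃ₗ[A] (ι → torsionBySet A M s) where
  toFun x i := ⟨x.1 i, (mem_torsionBySet_iff ..).mpr fun c =>
    congrFun ((mem_torsionBySet_iff ..).mp x.2 c) i⟩
  invFun y := ⟨fun i => (y i).1, (mem_torsionBySet_iff ..).mpr fun c => funext fun i =>
    (mem_torsionBySet_iff ..).mp (y i).2 c⟩
  map_add' _ _ := rfl
  map_smul' _ _ := rfl

/-- The `s`-torsion of the `a`-torsion is the `s`-torsion if `a ∈ s`. -/
def torsionBySetTorsionBy {s : Set A} {a : A} (ha : a ∈ s) :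
    torsionBySet A (torsionBy A M a) s ≃ₗ[A] torsionBySet A M s where
  toFun x := ⟨x.1.1, (mem_torsionBySet_iff ..).mpr fun c =>
    congrArg Subtype.val ((mem_torsionBySet_iff ..).mp x.2 c)⟩
  invFun x := ⟨⟨x.1, (mem_torsionBySet_iff ..).mp x.2 ⟨a, ha⟩⟩, (mem_torsionBySet_iff ..).mpr
    fun c => Subtype.ext ((mem_torsionBySet_iff ..).mp x.2 c)⟩
  map_add' _ _ := rfl
  map_smul' _ _ := rfl

end Submodule

/-- The snake lemma for multiplication by `a` on `0 → Λ → V → M → 0`, in the case that `a` acts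
bijectively on `V`. -/
theorem LinearMap.nonempty_torsionBy_equiv_quotient_smul_ker {A V M : Type*} [CommRing A]
    [AddCommGroup V] [Module A V] [AddCommGroup M] [Module A M] (e : V →ₗ[A] M)
    (he : Function.Surjective e) {a : A} (ha : Function.Bijective fun v : V => a • v) :
    Nonempty ((ker e ⧸ (Ideal.span {a} • ⊤ : Submodule A (ker e))) ≃ₗ[A]
      Submodule.torsionBy A M a) := by
  let α : V ≃ₗ[A] V := LinearEquiv.ofBijective (LinearMap.lsmul A V a) ha
  have hα : ∀ v, a • α.symm v = v := α.apply_symm_apply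
  let f : ker e →ₗ[A] Submodule.torsionBy A M a :=
    LinearMap.codRestrict _ (e ∘ₗ α.symm.toLinearMap ∘ₗ (ker e).subtype) fun x => by
      rw [Submodule.mem_torsionBy_iff]
      change a • e (α.symm x) = 0
      rw [← map_smul, hα]
      exact x.2
  have hf : ∀ x, (f x : M) = e (α.symm x) := fun x => rfl
  have hsurj : Function.Surjective f := by
    rintro ⟨m, hm⟩
    obtain ⟨v, rfl⟩ := he m
    rw [Submodule.mem_torsionBy_iff, ← map_smul] at hm
    exact ⟨⟨a • v, hm⟩, Subtype.ext ((hf _).trans (congrArg e (α.symm_apply_apply v)))⟩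
  have hker : ker f = Ideal.span {a} • ⊤ := by
    ext x
    rw [Submodule.ideal_span_singleton_smul, Submodule.mem_smul_pointwise_iff_exists, mem_ker]
    constructor
    · intro hx
      exact ⟨⟨α.symm x, congrArg Subtype.val hx⟩, trivial, Subtype.ext (hα x)⟩
    · rintro ⟨y, -, rfl⟩
      exact Subtype.ext ((hf _).trans ((congrArg e (α.symm_apply_apply y.1)).trans y.2))
  exact ⟨(Submodule.quotEquivOfEq _ _ hker.symm).trans (f.quotKerEquivOfSurjective hsurj)⟩

/-- The torsion of the quotient of a uniquely divisible module by a finitely generated torsion-free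
submodule of rank `r` over a Dedekind domain is free of rank `r`. -/
theorem IsDedekindDomain.nonempty_torsionBySet_equiv {A V M : Type*} [CommRing A]
    [IsDedekindDomain A] [AddCommGroup V] [Module A V] [AddCommGroup M] [Module A M]
    (e : V →ₗ[A] M) (he : Function.Surjective e)
    (hV : ∀ a : A, a ≠ 0 → Function.Bijective fun v : V => a • v)
    [Module.Finite A (LinearMap.ker e)] {𝔞 : Ideal A} (h𝔞 : 𝔞 ≠ ⊥) :
    Nonempty (Submodule.torsionBySet A M (𝔞 : Set A) ≃ₗ[A ⧸ 𝔞]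
      (Fin (Module.finrank A (LinearMap.ker e)) → A ⧸ 𝔞)) := by
  have : Module.IsTorsionFree A V := .of_smul_eq_zero fun a v h => by
    by_contra! hav
    exact hav.2 ((hV a hav.1).1 (h.trans (smul_zero a).symm))
  obtain ⟨a, ha, ha0⟩ := Submodule.exists_mem_ne_zero_of_ne_bot h𝔞
  obtain ⟨b⟩ := Module.nonempty_basis_quotient_span_singleton_tensorProduct (LinearMap.ker e) ha0
  obtain ⟨e₁⟩ := e.nonempty_torsionBy_equiv_quotient_smul_ker he (hV a ha0)
  obtain ⟨e₂⟩ := IsDedekindDomain.nonempty_quotient_equiv_torsionBySet ha0 ha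
  let e₃ : Submodule.torsionBy A M a ≃ₗ[A]
      (Fin (Module.finrank A (LinearMap.ker e)) → A ⧸ Ideal.span {a}) :=
    e₁.symm.trans ((TensorProduct.quotTensorEquivQuotSMul _ _).symm.trans
      (b.equivFun.restrictScalars A))
  let e₄ : Submodule.torsionBySet A M (𝔞 : Set A) ≃ₗ[A]
      (Fin (Module.finrank A (LinearMap.ker e)) → A ⧸ 𝔞) :=
    (Submodule.torsionBySetTorsionBy ha).symm.trans ((Submodule.torsionBySetCongr _ e₃).trans
      ((Submodule.torsionBySetPi _).trans (LinearEquiv.piCongrRight fun _ => e₂.symm)))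
  exact ⟨e₄.extendScalarsOfSurjective Ideal.Quotient.mk_surjective⟩

end

/-! ### Zeros of additive polynomials -/

/-- The elements of `F` are the only fixed points of the `#F`-power Frobenius. -/
theorem FiniteField.mem_range_algebraMap_of_pow_card_eq {F C : Type*} [Field F] [Fintype F]
    [Field C] [Algebra F C] {c : C} (hc : c ^ Fintype.card F = c) :
    c ∈ Set.range (algebraMap F C) := by
  have hprod := Polynomial.prod_multiset_X_sub_C_of_monic_of_roots_card_eq
    (p := (Polynomial.X ^ Fintype.card F - Polynomial.X : Polynomial F))
    (Polynomial.monic_X_pow_sub (by simpa using Fintype.one_lt_card))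
    (by rw [roots_X_pow_card_sub_X, X_pow_card_sub_X_natDegree_eq F Fintype.one_lt_card]; rfl)
  rw [roots_X_pow_card_sub_X] at hprod
  change ∏ a : F, (Polynomial.X - Polynomial.C a) = _ at hprod
  have h := congrArg (Polynomial.aeval c) hprod
  simp only [map_prod, map_sub, Polynomial.aeval_X, Polynomial.aeval_C, map_pow, hc, sub_self] at h
  obtain ⟨a, -, ha⟩ := Finset.prod_eq_zero_iff.mp h
  exact ⟨a, (sub_eq_zero.mp ha).symm⟩

/-- If the `C`-linear relations between the values of an injective `F`-linear map are stable under
the Frobenius of `C`, then this map preserves linear independence: a shortest relation, normalized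
to have a coefficient `1`, has its coefficients in `F`. -/
theorem LinearIndependent.of_frobenius_stable {F C W Z ι : Type*} [Field F] [Fintype F] [Field C]
    [Algebra F C] [AddCommGroup W] [Module F W] [AddCommGroup Z] [Module F Z] [Module C Z]
    [IsScalarTower F C Z] (Y : W →ₗ[F] Z) (hY : Function.Injective Y) {x : ι → W}
    (hfrob : ∀ (s : Finset ι) (c : ι → C), ∑ i ∈ s, c i • Y (x i) = 0 →
      ∑ i ∈ s, c i ^ Fintype.card F • Y (x i) = 0)
    (hx : LinearIndependent F x) : LinearIndependent C fun i => Y (x i) := by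
  classical
  rw [linearIndependent_iff']
  intro s
  induction s using Finset.induction_on with
  | empty => simp
  | insert a s ha ih =>
    intro g hg
    by_cases hga : g a = 0
    · rw [Finset.sum_insert ha, hga, zero_smul, zero_add] at hg
      simpa [hga] using ih g hg
    exfalso
    set g' : ι → C := fun i => (g a)⁻¹ * g i with hg'
    have hg'a : g' a = 1 := inv_mul_cancel₀ hga
    have h1 : ∑ i ∈ insert a s, g' i • Y (x i) = 0 := by
      simp only [hg', mul_smul, ← Finset.smul_sum, hg, smul_zero]
    have h2 : ∑ i ∈ s, (g' i ^ Fintype.card F - g' i) • Y (x i) = 0 := by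
      have h3 := hfrob _ _ h1
      rw [Finset.sum_insert ha, hg'a] at h1 h3
      simp only [sub_smul, Finset.sum_sub_distrib]
      rw [one_pow] at h3
      exact sub_eq_zero.mpr (add_left_cancel (h3.trans h1.symm))
    have h4 : ∀ i, i ∈ insert a s → ∃ f : F, algebraMap F C f = g' i := by
      intro i hi
      apply FiniteField.mem_range_algebraMap_of_pow_card_eq
      rcases Finset.mem_insert.mp hi with rfl | hi
      · rw [hg'a, one_pow]
      · exact sub_eq_zero.mp (ih _ h2 i hi)
    choose! f hf using h4
    have h5 : Y (∑ i ∈ insert a s, f i • x i) = 0 := by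
      rw [map_sum, ← h1]
      refine Finset.sum_congr rfl fun i hi => ?_
      rw [map_smul, ← hf i hi, algebraMap_smul]
    have h6 := linearIndependent_iff'.mp hx _ f (hY (h5.trans (map_zero Y).symm)) a
      (Finset.mem_insert_self a s)
    have h7 := hf a (Finset.mem_insert_self a s)
    rw [h6, map_zero, hg'a] at h7
    exact zero_ne_one h7

/-- The coordinatewise `qⁿ`-power map `x ↦ x^{(qⁿ)}`, where `q` is the cardinality of `F`. -/
def frobeniusVec (F : Type*) {C ι : Type*} [Field F] [Fintype F] [Field C] [Algebra F C] (n : ℕ) :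
    (ι → C) →ₗ[F] (ι → C) where
  toFun x i := x i ^ Fintype.card F ^ n
  map_add' x y := funext fun i => add_pow_card_pow F n (x i) (y i)
  map_smul' c x := funext fun i => by
    simp only [Pi.smul_apply, RingHom.id_apply, Algebra.smul_def, mul_pow]
    rw [← map_pow, FiniteField.pow_card_pow]

theorem frobeniusVec_apply {F C ι : Type*} [Field F] [Fintype F] [Field C] [Algebra F C] (n : ℕ)
    (x : ι → C) (i : ι) : frobeniusVec F n x i = x i ^ Fintype.card F ^ n := rfl

theorem frobeniusVec_zero {F C ι : Type*} [Field F] [Fintype F] [Field C] [Algebra F C]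
    (x : ι → C) : frobeniusVec F 0 x = x := funext fun i => by simp [frobeniusVec_apply]

/-- A system of additive polynomials `∑ₙ Nₙ x^{(qⁿ)}` with `N₀` injective has only finitely many
zeros: by the vanishing of the system, the relations between the vectors
`(x^{(q)}, …, x^{(q^{k+1})})` attached to its zeros `x` also hold between the zeros themselves, so
that they are stable under Frobenius. Hence the zeros have `F`-dimension at most `(k + 1) d`. -/
theorem finite_setOf_sum_mulVec_frobeniusVec_eq_zero {F C : Type*} [Field F] [Fintype F] [Field C]
    [Algebra F C] {d : ℕ} (N : ℕ → Matrix (Fin d) (Fin d) C)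
    (hN : Function.Injective (N 0).mulVec) (k : ℕ) :
    {x : Fin d → C | ∑ n ∈ Finset.range (k + 2),
      (N n).mulVec (frobeniusVec F n x) = 0}.Finite := by
  let P : (Fin d → C) →ₗ[F] (Fin d → C) :=
    ∑ n ∈ Finset.range (k + 2), ((N n).mulVecLin.restrictScalars F) ∘ₗ frobeniusVec F n
  have hP : ∀ x, P x = ∑ n ∈ Finset.range (k + 2), (N n).mulVec (frobeniusVec F n x) := fun x => by
    simp [P, LinearMap.sum_apply]
  let Y : LinearMap.ker P →ₗ[F] (Fin (k + 1) → Fin d → C) :=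
    LinearMap.pi fun j => frobeniusVec F (j + 1) ∘ₗ (LinearMap.ker P).subtype
  have hYapp : ∀ x j, Y x j = frobeniusVec F (j + 1) x.1 := fun _ _ => rfl
  have hY : Function.Injective Y := by
    rw [injective_iff_map_eq_zero]
    intro x hx
    ext i
    have := congrFun (congrFun hx 0) i
    exact pow_eq_zero_iff (pow_ne_zero _ Fintype.card_ne_zero) |>.mp this
  have hli : ∀ s : Finset (LinearMap.ker P), LinearIndependent F (fun i : s => (i : LinearMap.ker P))
      → s.card ≤ Module.finrank C (Fin (k + 1) → Fin d → C) := by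
    intro s hs
    rw [← Fintype.card_coe]
    refine LinearIndependent.fintype_card_le_finrank
      (hs.of_frobenius_stable (C := C) Y hY fun t c hc => ?_)
    -- the relation also holds between the zeros themselves
    have h0 : ∑ i ∈ t, c i • i.1.1 = 0 := by
      apply hN
      rw [Matrix.mulVec_zero]
      have h1 : ∀ n ∈ Finset.range (k + 1),
          (N (n + 1)).mulVec (∑ i ∈ t, c i • frobeniusVec F (n + 1) i.1.1) = 0 := by
        intro n hn
        have := congrFun hc ⟨n, Finset.mem_range.mp hn⟩
        simp only [Finset.sum_apply, Pi.smul_apply, hYapp, Pi.zero_apply] at this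
        rw [this, Matrix.mulVec_zero]
      have h2 : ∑ i ∈ t, c i • P i.1.1 = 0 :=
        Finset.sum_eq_zero fun i _ => by rw [LinearMap.mem_ker.mp i.1.2, smul_zero]
      simp only [hP, Finset.smul_sum] at h2
      rw [Finset.sum_comm, Finset.sum_range_succ'] at h2
      rw [← h2]
      simp only [← Matrix.mulVec_smul, ← Matrix.mulVec_sum, frobeniusVec_zero]
      rw [Finset.sum_eq_zero h1, zero_add]
    have h3 : ∀ j, j < k + 1 → ∑ i ∈ t, c i • frobeniusVec F j i.1.1 = 0 := by
      rintro (_ | j) hj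
      · simpa only [frobeniusVec_zero] using h0
      · have := congrFun hc ⟨j, by omega⟩
        simpa only [Finset.sum_apply, Pi.smul_apply, hYapp, Pi.zero_apply] using this
    funext j l
    have h4 := congrFun (congrArg (frobeniusVec F 1) (h3 j j.2)) l
    rw [map_sum, map_zero, Finset.sum_apply] at h4
    simp only [frobeniusVec_apply, Pi.smul_apply, smul_eq_mul, Pi.zero_apply] at h4
    simp only [Finset.sum_apply, Pi.smul_apply, hYapp, frobeniusVec_apply, smul_eq_mul,
      Pi.zero_apply]
    rw [← h4]
    refine Finset.sum_congr rfl fun i _ => ?_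
    rw [mul_pow, pow_one, ← pow_mul, ← pow_succ]
  have hrank : Module.rank F (LinearMap.ker P) < Cardinal.aleph0 :=
    (rank_le hli).trans_lt (Cardinal.natCast_lt_aleph0)
  have : Module.Finite F (LinearMap.ker P) := Module.rank_lt_aleph0_iff.mp hrank
  have : Finite (LinearMap.ker P) := Module.finite_of_finite F
  refine (Set.toFinite (LinearMap.ker P : Set (Fin d → C))).subset fun x hx => ?_
  rw [SetLike.mem_coe, LinearMap.mem_ker, hP]
  exact hx

namespace AndersonModule

variable {F A L : Type*} [Field F] [Fintype F] [CommRing A] [Field L] [Algebra F L] [Algebra A L]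
  {d : ℕ} (C : Type*) [Field C] [Algebra F C] [Algebra L C]

/-- If `dφ_a` is invertible, then `φ_a` is étale, and its kernel is finite. -/
theorem finite_setOf_smul_eq_zero (E : AndersonModule F A L d) {a : A} (ha : IsUnit (E.dφ a)) :
    {x : E.Points C | a • x = 0}.Finite := by
  classical
  let N (n : ℕ) : Matrix (Fin d) (Fin d) C :=
    Matrix.of fun i j => algebraMap L C (TwistedPolynomial.coeff (E.φ a i j) n)
  have hN : Function.Injective (N 0).mulVec := by
    rw [Matrix.mulVec_injective_iff_isUnit]
    exact ha.map (algebraMap L C).mapMatrix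
  let k := Finset.univ.sup fun i => Finset.univ.sup fun j =>
    (SkewPolynomial.support (E.φ a i j)).sup id
  refine (finite_setOf_sum_mulVec_frobeniusVec_eq_zero (F := F) N hN k).subset fun x hx => ?_
  have hx' : E.action C a x = 0 := hx
  rw [Set.mem_ofPred, ← hx']
  funext i
  rw [action_apply, Finset.sum_apply]
  simp only [Matrix.mulVec, dotProduct]
  rw [Finset.sum_comm]
  refine Finset.sum_congr rfl fun j _ => ?_
  symm
  refine Finset.sum_subset (fun n hn => ?_) fun n _ hn => ?_
  · have h1 : n ≤ (SkewPolynomial.support (E.φ a i j)).sup id := Finset.le_sup (f := id) hn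
    have h2 : (SkewPolynomial.support (E.φ a i j)).sup id ≤ Finset.univ.sup fun j =>
      (SkewPolynomial.support (E.φ a i j)).sup id :=
        Finset.le_sup (f := fun j => (SkewPolynomial.support (E.φ a i j)).sup id)
          (Finset.mem_univ j)
    have h3 : (Finset.univ.sup fun j => (SkewPolynomial.support (E.φ a i j)).sup id) ≤ k :=
      Finset.le_sup (f := fun i => Finset.univ.sup fun j =>
        (SkewPolynomial.support (E.φ a i j)).sup id) (Finset.mem_univ i)
    exact Finset.mem_range.mpr (by omega)
  · have : TwistedPolynomial.coeff (E.φ a i j) n = 0 := SkewPolynomial.notMem_support_iff.mp hn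
    rw [this, map_zero, zero_mul]

end AndersonModule

/-! ### The exponential map as a linear map -/

namespace TwistedPolynomial

variable {F L : Type*} [Field F] [Fintype F] [Field L] [Algebra F L]

variable (F L) in
/-- The constant coefficient of a twisted polynomial, as a ring homomorphism: it is evaluation at
`τ = 0`. -/
noncomputable def constantCoeff : TwistedPolynomial F L →+* L :=
  SkewMonoidAlgebra.liftNCRingHom (k := FrobeniusCopy F L) (G := Multiplicative ℕ)
    (RingHom.id L) (powersHom L 0) (by
      intro l n
      change (show L from l) ^ Fintype.card F ^ n.toAdd * (0 : L) ^ n.toAdd =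
        (0 : L) ^ n.toAdd * (show L from l)
      rcases Nat.eq_zero_or_pos n.toAdd with hn | hn
      · rw [hn, pow_zero, pow_zero, pow_one, mul_comm]
      · rw [zero_pow hn.ne', mul_zero, zero_mul])

theorem constantCoeff_apply (f : TwistedPolynomial F L) : constantCoeff F L f = coeff f 0 := by
  have h (n : ℕ) (l : L) :
      constantCoeff F L (SkewPolynomial.monomial (R := FrobeniusCopy F L) n l) = l * 0 ^ n :=
    SkewMonoidAlgebra.liftNC_single _ _ _ _
  have h' : (constantCoeff F L).toAddMonoidHom =
      (⟨⟨fun f => coeff f 0, SkewPolynomial.coeff_zero (R := FrobeniusCopy F L) 0⟩, fun f g =>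
        SkewPolynomial.coeff_add (R := FrobeniusCopy F L) f g 0⟩ : TwistedPolynomial F L →+ L) := by
    refine SkewPolynomial.addHom_ext (R := FrobeniusCopy F L) fun n l => ?_
    have h2 : coeff (SkewPolynomial.monomial (R := FrobeniusCopy F L) n l) 0 =
        if n = 0 then l else 0 := SkewPolynomial.coeff_monomial
    refine (h n l).trans (Eq.trans ?_ h2.symm)
    split_ifs with hn
    · rw [hn, pow_zero]; exact mul_one (M := L) l
    · rw [zero_pow hn]; exact mul_zero (M₀ := L) l
  exact DFunLike.congr_fun h' f

end TwistedPolynomial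

namespace AndersonModule

variable {F A L : Type*} [Field F] [Fintype F] [CommRing A] [Field L] [Algebra F L] [Algebra A L]
  {d : ℕ}

/-- The ring homomorphism `a ↦ dφ_a`. -/
noncomputable def dφHom (E : AndersonModule F A L d) : A →+* Matrix (Fin d) (Fin d) L :=
  (TwistedPolynomial.constantCoeff F L).mapMatrix.comp E.φ

theorem dφHom_apply (E : AndersonModule F A L d) (a : A) : E.dφHom a = E.dφ a :=
  Matrix.ext fun _ _ => TwistedPolynomial.constantCoeff_apply _

theorem isUnit_dφ (E : AndersonModule F A L d) {a : A} (ha : algebraMap A L a ≠ 0) :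
    IsUnit (E.dφ a) := by
  have h := (Matrix.scalar_commute (algebraMap A L a) (fun _ => Commute.all _ _)
    (E.dφ a - Matrix.scalar (Fin d) (algebraMap A L a)))
  have := (E.isNilpotent_sub a).isUnit_add_right_of_commute
    ((IsUnit.mk0 _ ha).map (Matrix.scalar (Fin d))) h.symm
  simpa [dφ] using this

/-- If `n` is a large power of the characteristic, then `dφ_{aⁿ} = (dφ_a)ⁿ` is the sum of the `n`-th
powers of `a` and of the nilpotent part of `dφ_a`, and the latter vanishes. -/
theorem exists_dφ_pow_eq_scalar (E : AndersonModule F A L d) (a : A) :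
    ∃ n, n ≠ 0 ∧ E.dφ (a ^ n) = Matrix.scalar (Fin d) (algebraMap A L (a ^ n)) := by
  obtain ⟨p, hp⟩ := CharP.exists F
  have hprime : p.Prime := (CharP.char_is_prime_or_zero F p).resolve_right
    fun h0 => by subst h0; exact CharP.char_ne_zero_of_finite F 0 rfl
  obtain ⟨m, hm⟩ := E.isNilpotent_sub a
  refine ⟨p ^ m, pow_ne_zero _ hprime.ne_zero, ?_⟩
  rcases Nat.eq_zero_or_pos d with rfl | hd
  · exact Subsingleton.elim _ _
  have : Nonempty (Fin d) := ⟨⟨0, hd⟩⟩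
  have : CharP L p := charP_of_injective_algebraMap (algebraMap F L).injective p
  have : ExpChar (Matrix (Fin d) (Fin d) L) p := .prime hprime
  have h := sub_pow_expChar_pow_of_commute p m
    (Matrix.scalar_commute (algebraMap A L a) (fun _ => Commute.all _ _) (E.dφ a)).symm
  have h0 : (E.dφ a - Matrix.scalar (Fin d) (algebraMap A L a)) ^ p ^ m = 0 :=
    pow_eq_zero_of_le (Nat.lt_pow_self hprime.one_lt).le hm
  rw [← dφHom_apply, map_pow, dφHom_apply, map_pow, map_pow]
  exact sub_eq_zero.mp (h.symm.trans h0)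

variable (C : Type*) [Field C] [Algebra L C]

/-- The Lie algebra `Lie(E)(C) = C^d`, as an `A`-module via `dφ`. -/
def LiePoints (_E : AndersonModule F A L d) (C : Type*) : Type _ := Fin d → C

instance (E : AndersonModule F A L d) : AddCommGroup (E.LiePoints C) :=
  inferInstanceAs (AddCommGroup (Fin d → C))

/-- The action of `A` on `Lie(E)(C)` through `dφ`. -/
noncomputable def lieAction (E : AndersonModule F A L d) : A →+* Module.End C (Fin d → C) :=
  (Matrix.toLinAlgEquiv' : Matrix (Fin d) (Fin d) C ≃ₐ[C] _).toRingEquiv.toRingHom.comp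
    ((algebraMap L C).mapMatrix.comp E.dφHom)

noncomputable instance (E : AndersonModule F A L d) : Module A (E.LiePoints C) :=
  letI : Module (Module.End C (Fin d → C)) (E.LiePoints C) :=
    inferInstanceAs (Module (Module.End C (Fin d → C)) (Fin d → C))
  Module.compHom (E.LiePoints C) (E.lieAction C)

variable {C}

theorem liePoints_smul_def (E : AndersonModule F A L d) (a : A) (x : E.LiePoints C) :
    a • x = ((E.dφ a).map (algebraMap L C)).mulVec x := by
  rw [← dφHom_apply]
  rfl

theorem liePoints_smul_of_dφ_eq_scalar (E : AndersonModule F A L d) {a : A}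
    (ha : E.dφ a = Matrix.scalar (Fin d) (algebraMap A L a)) (x : E.LiePoints C) (i : Fin d) :
    (a • x) i = algebraMap L C (algebraMap A L a) * x i := by
  rw [liePoints_smul_def, ha, Matrix.scalar_apply, Matrix.diagonal_map (map_zero _)]
  exact Matrix.mulVec_diagonal _ _ i

theorem bijective_smul_liePoints (E : AndersonModule F A L d) {a : A}
    (ha : algebraMap A L a ≠ 0) : Function.Bijective fun x : E.LiePoints C => a • x := by
  have h : IsUnit ((E.dφ a).map (algebraMap L C)) :=
    (E.isUnit_dφ ha).map (algebraMap L C).mapMatrix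
  simp only [liePoints_smul_def]
  exact ⟨Matrix.mulVec_injective_of_isUnit h, Matrix.mulVec_surjective_iff_isUnit.mpr h⟩

variable [Algebra F C]

/-- An exponential map is `A`-linear from `Lie(E)` to `E`. -/
noncomputable def IsExponential.linearMap [TopologicalSpace C] [IsTopologicalRing C] [T2Space C]
    {E : AndersonModule F A L d} {e : (Fin d → C) → E.Points C} (he : E.IsExponential C e) :
    E.LiePoints C →ₗ[A] E.Points C where
  toFun := e
  map_add' x y := by
    obtain ⟨⟨c, -, hc⟩, -⟩ := he
    refine HasSum.unique (α := Fin d → C) (hc (x + y)) ?_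
    refine (HasSum.add (α := Fin d → C) (hc x) (hc y)).congr_fun fun n => ?_
    rw [← Matrix.mulVec_add]
    exact congrArg _ (map_add (frobeniusVec F n) x y)
  map_smul' a x := by
    rw [liePoints_smul_def]
    exact (he.2 a x).symm

end AndersonModule

/-! ### The period lattice -/

section

open Filter Topology

namespace Valued

variable {C Γ₀ : Type*} [Field C] [LinearOrderedCommGroupWithZero Γ₀] [Valued C Γ₀]

theorem setOf_lt_mem_nhds_zero {x : C} (hx : x ≠ 0) : {y : C | v y < v x} ∈ 𝓝 (0 : C) := by
  rw [mem_nhds_zero]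
  refine ⟨Units.mk0 (v.restrict x) (by simpa using hx), fun y hy => ?_⟩
  exact v.restrict_lt_iff.mp hy

/-- By the ultrametric inequality, a series whose first term strictly dominates all others does not
sum to zero. -/
theorem not_hasSum_zero_of_lt {f : ℕ → C} (h0 : f 0 ≠ 0) (hf : ∀ n, v (f (n + 1)) < v (f 0)) :
    ¬ HasSum f 0 := by
  intro h
  have h1 := (h.tendsto_sum_nat.comp (tendsto_add_atTop_nat 1)).eventually
    (setOf_lt_mem_nhds_zero h0)
  obtain ⟨n, hn⟩ := h1.exists
  have h2 : v (∑ i ∈ Finset.range (n + 1), f i) = v (f 0) := by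
    rw [Finset.sum_range_succ']
    exact Valuation.map_add_eq_of_lt_right _
      (Valuation.map_sum_lt _ ((Valuation.ne_zero_iff _).mpr h0) fun i _ => hf i)
  exact absurd h2 hn.ne

theorem exists_forall_le_pow_of_tendsto_zero {t : C} (ht : 1 < v t)
    (harch : ∀ x : C, ∃ n : ℕ, v x ≤ v t ^ n) {f : ℕ → C} (hf : Tendsto f atTop (𝓝 0)) :
    ∃ k, ∀ n, v (f n) ≤ v t ^ k := by
  obtain ⟨N, hN⟩ := eventually_atTop.mp (hf.eventually (setOf_lt_mem_nhds_zero one_ne_zero))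
  choose k hk using fun n => harch (f n)
  refine ⟨(Finset.range N).sup k, fun n => ?_⟩
  rcases lt_or_ge n N with hn | hn
  · exact (hk n).trans (pow_le_pow_right₀ ht.le (Finset.le_sup (Finset.mem_range.mpr hn)))
  · have := hN n hn
    rw [map_one] at this
    exact this.le.trans (one_le_pow₀ ht.le)

end Valued

namespace AndersonModule.IsExponential

variable {F A L : Type*} [Field F] [Fintype F] [CommRing A] [Field L] [Algebra F L] [Algebra A L]
  {d : ℕ} {C Γ₀ : Type*} [Field C] [Algebra F C] [Algebra L C] [LinearOrderedCommGroupWithZero Γ₀]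
  [Valued C Γ₀] {E : AndersonModule F A L d} {e : (Fin d → C) → E.Points C}

/-- The kernel of the exponential map is discrete: close to the origin the linear term of `e`
dominates. -/
theorem exists_forall_eq_zero (he : E.IsExponential C e) {t : C} (ht : 1 < Valued.v t)
    (harch : ∀ x : C, ∃ n : ℕ, Valued.v x ≤ Valued.v t ^ n) :
    ∃ k : ℕ, ∀ x : Fin d → C, (∀ i, Valued.v (x i) ≤ (Valued.v t ^ k)⁻¹) → e x = 0 → x = 0 := by
  obtain ⟨⟨c, hc0, hc⟩, -⟩ := he
  -- convergence at the standard basis vectors bounds the coefficients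
  have hlim : ∀ i j, Tendsto (fun n => c n i j) atTop (𝓝 0) := by
    intro i j
    have h1 := Summable.tendsto_atTop_zero (G := Fin d → C)
      ⟨_, hc (Pi.single j (1 : C))⟩
    have h2 := (tendsto_pi_nhds.mp h1) i
    refine h2.congr fun n => ?_
    have h3 : (fun i => (Pi.single j (1 : C) : Fin d → C) i ^ Fintype.card F ^ n) =
        Pi.single j (1 : C) := by
      funext l
      rcases eq_or_ne l j with rfl | hl
      · simp
      · simp [hl]
    rw [h3, Matrix.mulVec_single_one]
    rfl
  choose k hk using fun i j => Valued.exists_forall_le_pow_of_tendsto_zero ht harch (hlim i j)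
  let K := Finset.univ.sup fun i => Finset.univ.sup fun j => k i j
  have hK : ∀ n i j, Valued.v (c n i j) ≤ Valued.v t ^ K := fun n i j =>
    (hk i j n).trans (pow_le_pow_right₀ ht.le
      ((Finset.le_sup (f := fun j => k i j) (Finset.mem_univ j)).trans
        (Finset.le_sup (f := fun i => Finset.univ.sup fun j => k i j) (Finset.mem_univ i))))
  have ht0 : 0 < Valued.v t := zero_lt_one.trans ht
  refine ⟨K + 1, fun x hx hex => ?_⟩
  by_contra hx0
  obtain ⟨i₁, hi₁⟩ := Function.ne_iff.mp hx0
  have : Nonempty (Fin d) := ⟨i₁⟩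
  obtain ⟨i, hi⟩ := Finite.exists_max fun i => Valued.v (x i)
  have hxi : x i ≠ 0 := by
    refine (Valuation.ne_zero_iff Valued.v).mp ?_
    exact ((zero_lt_iff.mpr ((Valuation.ne_zero_iff Valued.v).mpr
      (show x i₁ ≠ 0 from hi₁))).trans_le (hi i₁)).ne'
  have hpos : 0 < Valued.v (x i) := zero_lt_iff.mpr ((Valuation.ne_zero_iff _).mpr hxi)
  have hle1 : Valued.v (x i) ≤ 1 := (hx i).trans (inv_le_one_of_one_le₀ (one_le_pow₀ ht.le))
  have hsum := (Pi.hasSum.mp (hc x)) i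
  rw [hex] at hsum
  have hzero : (c 0).mulVec (fun i => x i ^ Fintype.card F ^ 0) i = x i := by
    rw [hc0, Matrix.one_mulVec, pow_zero, pow_one]
  refine Valued.not_hasSum_zero_of_lt ?_ (fun n => ?_) hsum
  · rw [hzero]; exact hxi
  · rw [hzero]
    change Valued.v (∑ j, c (n + 1) i j * x j ^ Fintype.card F ^ (n + 1)) < _
    refine Valuation.map_sum_lt Valued.v hpos.ne' fun j _ => ?_
    rw [map_mul, map_pow]
    have hq : 2 ≤ Fintype.card F ^ (n + 1) :=
      Fintype.one_lt_card.trans_le (Nat.le_self_pow n.succ_ne_zero _)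
    calc Valued.v (c (n + 1) i j) * Valued.v (x j) ^ Fintype.card F ^ (n + 1)
        ≤ Valued.v t ^ K * Valued.v (x i) ^ 2 := by
          refine mul_le_mul' (hK _ _ _) ?_
          exact (pow_le_pow_left' (hi j) _).trans (pow_le_pow_right_of_le_one' hle1 hq)
      _ = (Valued.v t ^ K * Valued.v (x i)) * Valued.v (x i) := by rw [sq, mul_assoc]
      _ < 1 * Valued.v (x i) := by
          refine mul_lt_mul_of_pos_right ?_ hpos
          calc Valued.v t ^ K * Valued.v (x i) ≤ Valued.v t ^ K * (Valued.v t ^ (K + 1))⁻¹ :=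
                mul_le_mul_right (hx i) _
            _ < Valued.v t ^ (K + 1) * (Valued.v t ^ (K + 1))⁻¹ :=
                mul_lt_mul_of_pos_right (pow_lt_pow_right₀ ht K.lt_succ_self)
                  (inv_pos.mpr (pow_pos ht0 _))
            _ = 1 := mul_inv_cancel₀ (pow_pos ht0 _).ne'
      _ = Valued.v (x i) := one_mul _

/-- The elements of the period lattice of bounded size are finite in number. Enlarging the bound
by the factor `|T|` preserves finiteness, since `λ ↦ e(T⁻¹ λ)` maps the larger set to the finite
group `E[T]`, with fibres that are translates of subsets of `T` times the smaller set. -/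
theorem finite_setOf_le_pow (he : E.IsExponential C e) {T : A}
    (hT : E.dφ T = Matrix.scalar (Fin d) (algebraMap A L T))
    (ht : 1 < Valued.v (algebraMap L C (algebraMap A L T)))
    (harch : ∀ x : C, ∃ n : ℕ, Valued.v x ≤ Valued.v (algebraMap L C (algebraMap A L T)) ^ n)
    (m : ℕ) :
    {x : Fin d → C | e x = 0 ∧
      ∀ i, Valued.v (x i) ≤ Valued.v (algebraMap L C (algebraMap A L T)) ^ m}.Finite := by
  set t := algebraMap L C (algebraMap A L T) with htdef
  have ht0 : 0 < Valued.v t := zero_lt_one.trans ht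
  have htne : t ≠ 0 := (Valuation.ne_zero_iff _).mp ht0.ne'
  have hTne : algebraMap A L T ≠ 0 := fun h => htne (by rw [htdef, h, map_zero])
  have hsmul : ∀ (x : E.LiePoints C) (i : Fin d), (T • x) i = t * x i :=
    E.liePoints_smul_of_dφ_eq_scalar hT
  let S (γ : Γ₀) : Set (Fin d → C) := {x | e x = 0 ∧ ∀ i, Valued.v (x i) ≤ γ}
  obtain ⟨k, hk⟩ := he.exists_forall_eq_zero ht harch
  have hstep : ∀ γ, (S γ).Finite → (S (γ * Valued.v t)).Finite := by
    intro γ hγ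
    let f : (Fin d → C) → E.Points C := fun x => e (fun i => t⁻¹ * x i)
    have hf : ∀ x, T • f x = e x := by
      intro x
      let z : E.LiePoints C := fun i => t⁻¹ * x i
      have hz : T • z = x := funext fun i =>
        (hsmul z i).trans (mul_inv_cancel_left₀ htne (x i))
      exact (map_smul he.linearMap T z).symm.trans (congrArg e hz)
    refine Set.Finite.of_finite_fibers f
      ((E.finite_setOf_smul_eq_zero C (E.isUnit_dφ hTne)).subset ?_) ?_
    · rintro _ ⟨x, hx, rfl⟩
      exact (hf x).trans hx.1
    · rintro _ ⟨x₀, hx₀, rfl⟩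
      refine (hγ.image fun y i => x₀ i + t * y i).subset ?_
      rintro x ⟨hx, hxf⟩
      refine ⟨fun i => t⁻¹ * x i - t⁻¹ * x₀ i, ⟨?_, fun i => ?_⟩, ?_⟩
      · have := map_sub he.linearMap (fun i => t⁻¹ * x i) (fun i => t⁻¹ * x₀ i)
        exact this.trans (sub_eq_zero.mpr hxf)
      · beta_reduce
        rw [← mul_sub, map_mul, map_inv₀, inv_mul_le_iff₀ ht0, mul_comm]
        exact (Valuation.map_sub _ _ _).trans (max_le (hx.2 i) (hx₀.2 i))
      · funext i
        field_simp
        ring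
  have hfin : ∀ n, (S ((Valued.v t ^ k)⁻¹ * Valued.v t ^ n)).Finite := by
    intro n
    induction n with
    | zero =>
      refine (Set.finite_singleton (0 : Fin d → C)).subset fun x hx => hk x (fun i => ?_) hx.1
      simpa using hx.2 i
    | succ n ih => rw [pow_succ, ← mul_assoc]; exact hstep _ ih
  have := hfin (k + m)
  rwa [pow_add, inv_mul_cancel_left₀ (pow_pos ht0 k).ne'] at this

/-- The period lattice is finitely generated over any ring through which `T` acts. Subtracting a
representative of its class modulo `T` from a period and dividing by `T` makes the period smaller,
as long as it is large; so the finitely many periods below some bound generate. -/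
theorem finite_ker_linearMap (he : E.IsExponential C e) {T : A}
    (hT : E.dφ T = Matrix.scalar (Fin d) (algebraMap A L T))
    (ht : 1 < Valued.v (algebraMap L C (algebraMap A L T)))
    (harch : ∀ x : C, ∃ n : ℕ, Valued.v x ≤ Valued.v (algebraMap L C (algebraMap A L T)) ^ n)
    (hsurj : Function.Surjective e) (R : Type*) [CommRing R] [Algebra R A]
    [Module R (E.LiePoints C)] [IsScalarTower R A (E.LiePoints C)] (T' : R)
    (hT' : algebraMap R A T' = T) : Module.Finite R (LinearMap.ker he.linearMap) := by
  have hball := he.finite_setOf_le_pow hT ht harch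
  set t := algebraMap L C (algebraMap A L T) with htdef
  have ht0 : 0 < Valued.v t := zero_lt_one.trans ht
  have htne : t ≠ 0 := (Valuation.ne_zero_iff _).mp ht0.ne'
  have hTne : algebraMap A L T ≠ 0 := fun h => htne (by rw [htdef, h, map_zero])
  have hsmul : ∀ (x : E.LiePoints C) (i : Fin d), (T • x) i = t * x i :=
    E.liePoints_smul_of_dφ_eq_scalar hT
  -- the classes of periods modulo `T` correspond to the points `y` of `E[T]`
  have hfin := E.finite_setOf_smul_eq_zero C (E.isUnit_dφ hTne)
  choose u hu using (show ∀ y, ∃ x : E.LiePoints C, he.linearMap x = y from hsurj)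
  choose k hk using harch
  have : Finite {y : E.Points C | T • y = 0} := hfin
  have := Fintype.ofFinite {y : E.Points C | T • y = 0}
  obtain ⟨m, hm⟩ : ∃ m, ∀ y : E.Points C, T • y = 0 → ∀ i, Valued.v (t * u y i) ≤ Valued.v t ^ m :=
    ⟨Finset.univ.sup fun y : {y : E.Points C | T • y = 0} =>
      Finset.univ.sup fun i => k (t * u y i), fun y hy i =>
      (hk _).trans (pow_le_pow_right₀ ht.le
        ((Finset.le_sup (f := fun i => k (t * u y i)) (Finset.mem_univ i)).trans
          (Finset.le_sup (f := fun y : {y : E.Points C | T • y = 0} =>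
            Finset.univ.sup fun i => k (t * u y i)) (Finset.mem_univ ⟨y, hy⟩))))⟩
  let S : Set (LinearMap.ker he.linearMap) :=
    {x | ∀ i, Valued.v ((x : E.LiePoints C) i) ≤ Valued.v t ^ m}
  have hS : S.Finite := by
    refine Set.Finite.of_finite_image (f := Subtype.val) ((hball m).subset ?_)
      Subtype.val_injective.injOn
    rintro _ ⟨x, hx, rfl⟩
    exact ⟨x.2, hx⟩
  have hspan : ∀ (n : ℕ) (x : LinearMap.ker he.linearMap),
      (∀ i, Valued.v ((x : E.LiePoints C) i) ≤ Valued.v t ^ (m + n)) → x ∈ Submodule.span R S := by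
    intro n
    induction n with
    | zero => exact fun x hx => Submodule.subset_span hx
    | succ n ih =>
      intro x hx
      let z : E.LiePoints C := fun i => t⁻¹ * x.1 i
      have hTz : T • z = x.1 := funext fun i => by
        rw [hsmul]; exact mul_inv_cancel_left₀ htne _
      have hy : T • he.linearMap z = 0 := by rw [← map_smul, hTz]; exact x.2
      let y : E.Points C := he.linearMap z
      let w : LinearMap.ker he.linearMap := ⟨z - u y, by
        rw [LinearMap.mem_ker, map_sub]
        exact sub_eq_zero.mpr (hu y).symm⟩
      let r : LinearMap.ker he.linearMap := ⟨T • u y, by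
        rw [LinearMap.mem_ker, map_smul]
        exact (congrArg (T • ·) (hu y)).trans hy⟩
      have hr : r ∈ S := fun i => by
        change Valued.v ((T • u y) i) ≤ _
        rw [hsmul]
        exact hm y hy i
      have hw : w ∈ Submodule.span R S := by
        refine ih w fun i => ?_
        have h1 : w.1 i = t⁻¹ * (x.1 i - t * u y i) := by
          change t⁻¹ * x.1 i - u y i = _
          rw [mul_sub, inv_mul_cancel_left₀ htne]
        rw [h1, map_mul, map_inv₀, inv_mul_le_iff₀ ht0, ← pow_succ']
        refine (Valuation.map_sub _ _ _).trans (max_le (hx i) ((hm y hy i).trans ?_))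
        exact pow_le_pow_right₀ ht.le (by omega)
      have hx' : x = r + T' • w := by
        refine Subtype.ext ?_
        change x.1 = T • u y + T' • (z - u y)
        rw [← algebraMap_smul A T', hT', smul_sub, hTz, add_sub_cancel]
      rw [hx']
      exact add_mem (Submodule.subset_span hr) (Submodule.smul_mem _ _ hw)
  refine ⟨⟨hS.toFinset, ?_⟩⟩
  rw [Set.Finite.coe_toFinset, eq_top_iff]
  intro x _
  refine hspan (Finset.univ.sup fun i => k (x.1 i)) x fun i => (hk _).trans ?_
  exact pow_le_pow_right₀ ht.le ((Finset.le_sup (f := fun i => k (x.1 i))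
    (Finset.mem_univ i)).trans (Nat.le_add_left _ _))

end AndersonModule.IsExponential

end

/-! ### The ring of functions regular outside a point -/

section

open scoped IntermediateField.algebraAdjoinAdjoin

/-- The integral closure of a subring of a field is an intersection of valuation rings. -/
theorem isIntegral_of_forall_mem_valuationSubring {R K : Type*} [CommRing R] [Field K] [Algebra R K]
    {x : K} (h : ∀ V : ValuationSubring K, (∀ r : R, algebraMap R K r ∈ V) → x ∈ V) :
    IsIntegral R x := by
  let S : Subring K := (algebraMap R K).range
  have hx : x ∈ (integralClosure (Subring.closure (S : Set K)) K).toSubring := by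
    rw [← iInf_valuationSubring_superset, Subring.mem_iInf]
    exact fun V => h V.1 fun r => V.2 ⟨r, rfl⟩
  rw [Subring.closure_eq] at hx
  let _ : Algebra R S := (algebraMap R K).rangeRestrict.toAlgebra
  have : IsScalarTower R S K := .of_algebraMap_eq fun _ => rfl
  have : Algebra.IsIntegral R S :=
    Algebra.isIntegral_of_surjective (algebraMap R K).rangeRestrict_surjective
  exact isIntegral_trans (R := R) (A := S) x hx

/-- A function field of transcendence degree one is algebraic over each of its subrings `F[t]` with
`t` transcendental. -/
theorem IsCurveFunctionField.isAlgebraic_adjoin {F K : Type*} [Field F] [Field K] [Algebra F K]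
    (hK : IsCurveFunctionField F K) {t : K} (ht : Transcendental F t) :
    Algebra.IsAlgebraic (Algebra.adjoin F {t}) K := by
  obtain ⟨x, -, hx⟩ := hK.exists_finite
  have : Algebra.IsAlgebraic (Algebra.adjoin F {x}) K :=
    (IsFractionRing.comap_isAlgebraic_iff (K := F⟮x⟯)).mpr inferInstance
  have hle : Algebra.trdeg F K ≤ 1 :=
    (Algebra.IsAlgebraic.trdeg_le_cardinalMk F {x}).trans (Cardinal.mk_singleton x).le
  have hind : AlgebraicIndependent F fun _ : PUnit.{1} => t :=
    algebraicIndependent_unique_type_iff.mpr ht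
  have := (hind.isTranscendenceBasis_of_lift_trdeg_le_of_finite (by simpa using hle)).isAlgebraic
  rwa [Set.range_const] at this

theorem Algebra.isPrincipalIdealRing_adjoin_singleton (F : Type*) {A : Type*} [Field F] [CommRing A]
    [Algebra F A] (t : A) : IsPrincipalIdealRing (Algebra.adjoin F {t}) := by
  refine IsPrincipalIdealRing.of_surjective (Polynomial.aeval (R := F)
    (⟨t, Algebra.self_mem_adjoin_singleton F t⟩ : Algebra.adjoin F {t})) ?_
  rintro ⟨r, hr⟩
  obtain ⟨p, rfl⟩ := (Algebra.adjoin_singleton_eq_range_aeval F t ▸ hr :)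
  exact ⟨p, Subtype.ext (Polynomial.aeval_algHom_apply (Algebra.adjoin F {t}).val _ p).symm⟩

namespace Valuation

variable {F Ω Γ₀ : Type*} [Field F] [Field Ω] [Algebra F Ω] [LinearOrderedCommGroupWithZero Γ₀]
  (v : Valuation Ω Γ₀)

/-- On `F[t]`, a valuation that is trivial on `F` and large at `t` is determined by the degree. -/
theorem map_aeval_eq_pow_natDegree (hF : ∀ c : F, v (algebraMap F Ω c) ≤ 1) {t : Ω} (ht : 1 < v t)
    {p : Polynomial F} (hp : p ≠ 0) : v (Polynomial.aeval t p) = v t ^ p.natDegree := by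
  have hF1 : ∀ c : F, c ≠ 0 → v (algebraMap F Ω c) = 1 := by
    intro c hc
    refine le_antisymm (hF c) ?_
    have := hF c⁻¹
    rwa [map_inv₀, map_inv₀, inv_le_one₀
      (zero_lt_iff.mpr ((ne_zero_iff _).mpr ((map_ne_zero _).mpr hc)))] at this
  have hlead : v (algebraMap F Ω p.leadingCoeff * t ^ p.natDegree) = v t ^ p.natDegree := by
    rw [map_mul, hF1 _ (Polynomial.leadingCoeff_ne_zero.mpr hp), one_mul, map_pow]
  rw [Polynomial.aeval_eq_sum_range, Finset.sum_range_succ]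
  simp only [Algebra.smul_def]
  rw [map_add_eq_of_lt_right, Polynomial.coeff_natDegree, hlead]
  rw [Polynomial.coeff_natDegree, hlead]
  refine map_sum_lt _ (pow_pos (zero_lt_one.trans ht) _).ne' fun i hi => ?_
  rw [map_mul, map_pow]
  exact (mul_le_of_le_one_left' (hF _)).trans_lt
    (pow_lt_pow_right₀ ht (Finset.mem_range.mp hi))

/-- A valuation of an algebraic extension of `F(t)` that is trivial on `F` and large at `t` is
archimedean. -/
theorem exists_le_pow_of_isAlgebraic {K : Type*} [Field K] [Algebra F K] [Algebra K Ω]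
    [IsScalarTower F K Ω] (hF : ∀ c : F, v (algebraMap F Ω c) ≤ 1) {t : K}
    (ht : 1 < v (algebraMap K Ω t)) {y : Ω} (hy : IsAlgebraic (Algebra.adjoin F {t}) y) :
    ∃ n : ℕ, v y ≤ v (algebraMap K Ω t) ^ n := by
  -- the elements bounded by powers of `v t` form a valuation ring that contains `F(t)`
  let V : ValuationSubring Ω :=
    { carrier := {y | ∃ n : ℕ, v y ≤ v (algebraMap K Ω t) ^ n}
      mul_mem' := by
        rintro a b ⟨m, hm⟩ ⟨n, hn⟩
        exact ⟨m + n, by rw [map_mul, pow_add]; exact mul_le_mul' hm hn⟩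
      add_mem' := by
        rintro a b ⟨m, hm⟩ ⟨n, hn⟩
        refine ⟨max m n, (v.map_add a b).trans (max_le (hm.trans ?_) (hn.trans ?_))⟩
        · exact pow_le_pow_right₀ ht.le (le_max_left _ _)
        · exact pow_le_pow_right₀ ht.le (le_max_right _ _)
      one_mem' := ⟨0, by simp⟩
      zero_mem' := ⟨0, by simp⟩
      neg_mem' := by
        rintro a ⟨m, hm⟩
        exact ⟨m, by rwa [map_neg]⟩
      mem_or_inv_mem' := by
        intro a
        rcases le_total (v a) 1 with h | h
        · exact Or.inl ⟨0, by simpa using h⟩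
        · exact Or.inr ⟨0, by simpa using inv_le_one_of_one_le₀ h⟩ }
  have hR : ∀ r : Algebra.adjoin F {t}, r ≠ 0 →
      algebraMap K Ω r ∈ V ∧ (algebraMap K Ω r)⁻¹ ∈ V := by
    rintro ⟨r, hr⟩ hr0
    obtain ⟨p, rfl⟩ := (Algebra.adjoin_singleton_eq_range_aeval F t ▸ hr :)
    have hp : p ≠ 0 := by rintro rfl; exact hr0 (Subtype.ext (map_zero _))
    have := v.map_aeval_eq_pow_natDegree hF ht hp
    rw [Polynomial.aeval_algebraMap_apply] at this
    refine ⟨⟨_, this.le⟩, ⟨0, ?_⟩⟩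
    rw [map_inv₀, pow_zero]
    exact inv_le_one_of_one_le₀ (this.symm ▸ one_le_pow₀ ht.le)
  obtain ⟨r, hr0, hr⟩ := hy.exists_integral_multiple
  have hry : r • y ∈ V := by
    let _ : Algebra (Algebra.adjoin F {t}) V :=
      (((algebraMap K Ω).comp (Algebra.adjoin F {t}).subtype).codRestrict V.toSubring fun s => by
        by_cases h0 : s = 0
        · rw [h0, map_zero]; exact V.zero_mem
        · exact (hR s h0).1).toAlgebra
    have : IsScalarTower (Algebra.adjoin F {t}) V Ω := .of_algebraMap_eq fun _ => rfl
    obtain ⟨z, hz⟩ := IsIntegrallyClosed.isIntegral_iff.mp (hr.tower_top (A := V))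
    exact hz ▸ z.2
  have hyr : y = (algebraMap K Ω r)⁻¹ * (r • y) := by
    rw [Algebra.smul_def]
    exact (inv_mul_cancel_left₀ (by simpa using hr0) y).symm
  have : y ∈ V := by
    rw [hyr]
    exact V.mul_mem _ _ (hR r hr0).2 hry
  exact this

end Valuation

namespace ringRegularOutside

variable {F K : Type*} [Field F] [Field K] [Algebra F K] {infty : ValuationSubring K}

/-- A function without any pole is constant. -/
theorem notMem_of_transcendental {t : ringRegularOutside F infty} (ht : Transcendental F (t : K)) :
    (t : K) ∉ infty := by
  intro h
  refine ht (isIntegral_of_forall_mem_valuationSubring fun V hV => ?_).isAlgebraic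
  rcases eq_or_ne V ⊤ with rfl | hV1
  · exact ValuationSubring.mem_top _
  rcases eq_or_ne V infty with rfl | hV2
  · exact h
  exact t.2 V ⟨hV1, hV⟩ hV2

/-- The ring of functions regular outside `∞` is integral over `F[t]` for every element `t` with a
pole at `∞`. -/
theorem isIntegral_adjoin {t : ringRegularOutside F infty} (ht : (t : K) ∉ infty) :
    Algebra.IsIntegral (Algebra.adjoin F {t}) (ringRegularOutside F infty) := by
  refine ⟨fun a => ?_⟩
  rw [← isIntegral_algHom_iff (IsScalarTower.toAlgHom (Algebra.adjoin F {t})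
    (ringRegularOutside F infty) K) Subtype.val_injective]
  refine isIntegral_of_forall_mem_valuationSubring fun V hV => ?_
  rcases eq_or_ne V ⊤ with rfl | hV1
  · exact ValuationSubring.mem_top _
  refine a.2 V ⟨hV1, fun c => hV (algebraMap F _ c)⟩ ?_
  rintro rfl
  exact ht (hV ⟨t, Algebra.self_mem_adjoin_singleton F t⟩)

theorem isIntegrallyClosed : IsIntegrallyClosed (ringRegularOutside F infty) := by
  have h : IsIntegrallyClosedIn (ringRegularOutside F infty) K := by
    refine isIntegrallyClosedIn_iff.mpr ⟨Subtype.val_injective, fun {x} hx => ⟨⟨x, ?_⟩, rfl⟩⟩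
    intro P hP hne
    let _ : Algebra (ringRegularOutside F infty) P :=
      (Subring.inclusion (S := (ringRegularOutside F infty).toSubring) (T := P.toSubring)
        fun s hs => hs P hP hne).toAlgebra
    have : IsScalarTower (ringRegularOutside F infty) P K := .of_algebraMap_eq fun _ => rfl
    obtain ⟨z, hz⟩ := IsIntegrallyClosed.isIntegral_iff.mp (hx.tower_top (A := P))
    exact hz ▸ z.2
  exact AlgHom.isIntegrallyClosedIn (IsFractionRing.liftAlgHom (K := FractionRing _)
    (g := Algebra.ofId (ringRegularOutside F infty) K) Subtype.val_injective)
    (RingHom.injective _) h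

/-- Once it is known to be noetherian, the ring of functions regular outside `∞` is a Dedekind
domain. -/
theorem isDedekindDomain [IsNoetherianRing (ringRegularOutside F infty)]
    {t : ringRegularOutside F infty} (ht : (t : K) ∉ infty) :
    IsDedekindDomain (ringRegularOutside F infty) := by
  have := isIntegral_adjoin ht
  have := Algebra.isPrincipalIdealRing_adjoin_singleton F t
  have : Ring.DimensionLEOne (ringRegularOutside F infty) :=
    have := Ring.DimensionLEOne.principal_ideal_ring (Algebra.adjoin F {t})
    Ring.DimensionLEOne.of_isIntegral (Algebra.adjoin F {t}) _
  have : IsIntegrallyClosed (ringRegularOutside F infty) := isIntegrallyClosed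
  exact { }

end ringRegularOutside

end

/-! ### Regularity -/

namespace AndersonModule

variable {F A L C : Type*} [Field F] [Fintype F] [CommRing A] [Field L] [Algebra F L] [Algebra A L]
  {d : ℕ} [Field C] [Algebra F C] [Algebra L C]

/-- If `A` is a field, its only nonzero ideal is `A` itself, whose torsion is trivial. -/
theorem isRegular_of_isField (E : AndersonModule F A L d) (hA : IsField A) : E.IsRegular C := by
  let _ := hA.toField
  refine ⟨0, fun 𝔞 h𝔞 => ?_⟩
  have h1 : (1 : A) ∈ 𝔞 := (Ideal.eq_bot_or_top 𝔞).resolve_left h𝔞 ▸ Submodule.mem_top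
  have : Subsingleton (E.torsion C 𝔞) := ⟨fun x y => Subtype.ext <| by
    have h (z : E.torsion C 𝔞) : (z : E.Points C) = 0 :=
      (one_smul A _).symm.trans ((Submodule.mem_torsionBySet_iff ..).mp z.2 ⟨1, h1⟩)
    rw [h x, h y]⟩
  exact ⟨0, 0, fun _ => Subsingleton.elim _ _, fun _ => Subsingleton.elim _ _⟩

theorem isRegular_of_isTorsionFree [IsDomain A] (E : AndersonModule F A L d)
    [Module.IsTorsionFree A (E.Points C)] : E.IsRegular C := by
  refine ⟨0, fun 𝔞 h𝔞 => ?_⟩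
  obtain ⟨a, ha, ha0⟩ := Submodule.exists_mem_ne_zero_of_ne_bot h𝔞
  have : Subsingleton (E.torsion C 𝔞) := ⟨fun x y => Subtype.ext <| by
    have h (z : E.torsion C 𝔞) : (z : E.Points C) = 0 :=
      (smul_eq_zero_iff_right ha0).mp ((Submodule.mem_torsionBySet_iff ..).mp z.2 ⟨a, ha⟩)
    rw [h x, h y]⟩
  exact ⟨0, 0, fun _ => Subsingleton.elim _ _, fun _ => Subsingleton.elim _ _⟩

end AndersonModule

/-- A domain that acts on a nonzero torsion-free module embeds into it as the orbit of a nonzero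
element, so it inherits finiteness from the module. -/
theorem isNoetherianRing_of_finite_of_ne_zero {R A M : Type*} [CommRing R] [IsNoetherianRing R]
    [CommRing A] [IsDomain A] [Algebra R A] [AddCommGroup M] [Module A M] [Module R M]
    [IsScalarTower R A M] [Module.IsTorsionFree A M] [Module.Finite R M] {x : M} (hx : x ≠ 0) : IsNoetherianRing A := by
  have : IsNoetherian R A := isNoetherian_of_injective
    ((LinearMap.toSpanSingleton A M x).restrictScalars R) fun a b hab =>
      smul_left_injective A hx hab
  exact isNoetherian_of_tower R this

theorem mainTheorem7 {F K : Type*} [Field F] [Fintype F] [Field K] [Algebra F K]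
    (hK : IsCurveFunctionField F K)
    (infty : ValuationSubring K) (hinfty : IsClosedPoint F infty)
    (w : ValuationSubring (AlgebraicClosure K))
    (hw : w.comap (algebraMap K (AlgebraicClosure K)) = infty)
    (L : IntermediateField K (CInfty w)) {d : ℕ}
    (E : AndersonModule F (ringRegularOutside F infty) L d)
    (hE : E.IsUniformizable (CInfty w)) :
    E.IsRegular (CInfty w) := by
  obtain ⟨e, he, hsurj⟩ := hE
  -- Riemann–Roch excludes the first case, in which the torsion is trivially free of rank `0`
  by_cases hA : IsField (ringRegularOutside F infty)
  · exact E.isRegular_of_isField hA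
  obtain ⟨s, hs⟩ : ∃ s : ringRegularOutside F infty, Transcendental F s := by
    by_contra! h
    have : Algebra.IsAlgebraic F (ringRegularOutside F infty) :=
      ⟨fun a => not_not.mp (h a)⟩
    exact hA (isField_of_isIntegral_of_isField' (Field.toIsField F))
  -- a power of `s` acts on the Lie algebra as a scalar
  obtain ⟨n, hn, hT⟩ := E.exists_dφ_pow_eq_scalar s
  set T := s ^ n with hTdef
  have hTF : Transcendental F (T : K) :=
    (transcendental_algebraMap_iff (S := ringRegularOutside F infty) (A := K)
      Subtype.val_injective).mpr (hs.pow (Nat.pos_of_ne_zero hn))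
  have hTinf := ringRegularOutside.notMem_of_transcendental hTF
  have hmem : ∀ y : K, y ∈ infty ↔ algebraMap K (AlgebraicClosure K) y ∈ w := fun y => hw ▸ Iff.rfl
  -- the place `w` is trivial on `F` and large at `T`
  have hwF : ∀ c : F, w.valuation (algebraMap F (AlgebraicClosure K) c) ≤ 1 := by
    intro c
    rw [ValuationSubring.valuation_le_one_iff, IsScalarTower.algebraMap_apply F K]
    exact (hmem _).mp (hinfty.2 c)
  have hwT : 1 < w.valuation (algebraMap K (AlgebraicClosure K) T) := by
    rw [← not_le, ValuationSubring.valuation_le_one_iff]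
    exact fun h => hTinf ((hmem _).mpr h)
  have hval : ∀ y : AlgebraicClosure K,
      Valued.v ((WithVal.toVal w.valuation y : WithVal w.valuation) : CInfty w) = w.valuation y :=
    fun y => Valued.valuedCompletion_apply _
  have hvT : Valued.v (algebraMap L (CInfty w) (algebraMap (ringRegularOutside F infty) L T)) =
      w.valuation (algebraMap K (AlgebraicClosure K) T) := hval _
  have := hK.isAlgebraic_adjoin hTF
  have harch : ∀ x : CInfty w, ∃ n : ℕ, Valued.v x ≤
      Valued.v (algebraMap L (CInfty w) (algebraMap (ringRegularOutside F infty) L T)) ^ n := by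
    intro x
    obtain ⟨y, hy⟩ := Valued.exists_coe_eq_v x
    rw [hvT]
    have h1 : Algebra.IsAlgebraic (Algebra.adjoin F {(T : K)}) (AlgebraicClosure K) :=
      Algebra.IsAlgebraic.trans _ K _
    obtain ⟨n, hn⟩ :=
      w.valuation.exists_le_pow_of_isAlgebraic hwF hwT (h1.isAlgebraic y.ofVal)
    exact ⟨n, hy.le.trans hn⟩
  have hinj : Function.Injective (algebraMap (ringRegularOutside F infty) L) := by
    rw [IsScalarTower.algebraMap_eq (ringRegularOutside F infty) K L]
    exact (algebraMap K L).injective.comp Subtype.val_injective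
  have hV : ∀ a : ringRegularOutside F infty, a ≠ 0 →
      Function.Bijective fun x : E.LiePoints (CInfty w) => a • x := fun a ha =>
    E.bijective_smul_liePoints ((map_ne_zero_iff _ hinj).mpr ha)
  have htf : Module.IsTorsionFree (ringRegularOutside F infty) (E.LiePoints (CInfty w)) :=
    .of_smul_eq_zero fun a x h => by
      by_contra! hax
      exact hax.2 ((hV a hax.1).1 (h.trans (smul_zero a).symm))
  let R := Algebra.adjoin F {T}
  have := Algebra.isPrincipalIdealRing_adjoin_singleton F T
  have hfin : Module.Finite R (LinearMap.ker he.linearMap) :=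
    he.finite_ker_linearMap hT (hvT ▸ hwT) harch hsurj R
      ⟨T, Algebra.self_mem_adjoin_singleton F T⟩ rfl
  -- a nonzero period shows that `A` is noetherian
  rcases eq_or_ne (LinearMap.ker he.linearMap) ⊥ with hΛ | hΛ
  · have : Module.IsTorsionFree (ringRegularOutside F infty) (E.Points (CInfty w)) :=
      .of_smul_eq_zero fun a x h => by
        obtain ⟨z, rfl⟩ : ∃ z, he.linearMap z = x := hsurj x
        rw [← map_smul] at h
        rcases smul_eq_zero.mp (LinearMap.ker_eq_bot'.mp hΛ _ h) with h | h
        · exact Or.inl h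
        · exact Or.inr (by rw [h, map_zero])
    exact E.isRegular_of_isTorsionFree
  · obtain ⟨x, hx, hx0⟩ := Submodule.exists_mem_ne_zero_of_ne_bot hΛ
    have : IsNoetherianRing (ringRegularOutside F infty) :=
      isNoetherianRing_of_finite_of_ne_zero (R := R) (M := LinearMap.ker he.linearMap)
        (x := ⟨x, hx⟩) (by simpa [Subtype.ext_iff] using hx0)
    have := ringRegularOutside.isDedekindDomain hTinf
    have : Module.Finite (ringRegularOutside F infty) (LinearMap.ker he.linearMap) :=
      .of_restrictScalars_finite R _ _
    exact ⟨_, fun 𝔞 h𝔞 =>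
      IsDedekindDomain.nonempty_torsionBySet_equiv he.linearMap hsurj hV h𝔞⟩
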